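/- A chain ring is a (not necessarily commutative) ring with identity $1 \neq 0$ whose left ideals form a chain under inclusion and whose right ideals form a chain under inclusion. It has length (nilpotency index) $2$ if its Jacobson radical $\operatorname{rad} R$ satisfies $\operatorname{rad} R \neq 0$ and $(\operatorname{rad} R)^2 = 0$. For a finite chain ring $R$ of length $2$, let $\mathcal{P}$ and $\mathcal{L}$ be the sets of free rank $1$ and free rank $2$ submodules of the free right module $R^3_R$, respectively; the right projective Hjelmslev plane $\mathrm{PHG}(2,R)$ is the incidence structure $(\mathcal{P}, \mathcal{L}, \subseteq)$. A projective $(k,n)$-arc in $\mathrm{PHG}(2,R)$ is a map $\mathfrak{K} : \mathcal{P} \to \{0,1\}$ with $\sum_{x \in \mathcal{P}} \mathfrak{K}(x) = k$ and $\sum_{x \in \mathcal{P},\, x \subseteq L} \mathfrak{K}(x) \le n$ for every $L \in \mathcal{L}$. Let $\mathrm{m}_n(R)$ be the largest $k$ for which a projective $(k,n)$-arc in $\mathrm{PHG}(2,R)$ exists. **Theorem.** Let $q \ge 5$ be a prime power and let $R$ be a finite chain ring of length $2$ with residue field $R/\operatorname{rad} R \cong \mathbb{F}_q$. Then $$\mathrm{m}_3(R)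 \le \begin{cases} 2q^2 - 2q + 4 & \text{if } q \text{ is odd},\\ 2q^2 - q + 4 & \text{if } q \text{ is even}.\end{cases}$$ -/

import Mathlib

/-- A chain ring (not necessarily commutative): a nontrivial ring whose left ideals form a chain
under inclusion, and whose right ideals form a chain under inclusion. -/
structure IsChainRing (R : Type*) [Ring R] : Prop where
  nontrivial : Nontrivial R
  left_chain : ∀ I J : Submodule R R, I ≤ J ∨ J ≤ I
  right_chain : ∀ I J : Submodule Rᵐᵒᵖ R, I ≤ J ∨ J ≤ I

/-- A chain ring of length (nilpotency index) two: its radical is nonzero and has square zero. -/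
structure IsChainRingOfLengthTwo (R : Type*) [Ring R] : Prop extends IsChainRing R where
  radical_ne_bot : Ring.jacobson R ≠ ⊥
  radical_mul_eq_zero : ∀ a ∈ Ring.jacobson R, ∀ b ∈ Ring.jacobson R, a * b = 0

namespace PHG

/-- `N` is a free right `R`-module of rank `d` (right modules are modules over `Rᵐᵒᵖ`). -/
def IsFreeOfRank {R : Type*} [Ring R] (d : ℕ) (N : Submodule Rᵐᵒᵖ (Fin 3 → R)) : Prop :=
  Nonempty (Module.Basis (Fin d) Rᵐᵒᵖ N)

/-- The points of the right projective Hjelmslev plane over `R`: the free rank `1` submodules of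
the right module `R³`. -/
def Point (R : Type*) [Ring R] : Type _ :=
  {x : Submodule Rᵐᵒᵖ (Fin 3 → R) // IsFreeOfRank 1 x}

/-- The lines of the right projective Hjelmslev plane over `R`: the free rank `2` submodules of
the right module `R³`. -/
def Line (R : Type*) [Ring R] : Type _ :=
  {L : Submodule Rᵐᵒᵖ (Fin 3 → R) // IsFreeOfRank 2 L}

/-- The set of points incident with the line `L`; incidence is inclusion of submodules. -/
def Line.points {R : Type*} [Ring R] (L : Line R) : Set (Point R) :=
  {x | x.1 ≤ L.1}

/-- The multiplicity `K(S) = ∑_{x ∈ S} K(x)` of a point set `S` in the multiset `K`. -/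
noncomputable def multiplicity {R : Type*} [Ring R] (K : Point R → ℕ) (S : Set (Point R)) : ℕ :=
  ∑ᶠ x ∈ S, K x

/-- The multiset `K` of points is a `(k, n)`-arc. -/
def IsArc {R : Type*} [Ring R] (K : Point R → ℕ) (k n : ℕ) : Prop :=
  multiplicity K Set.univ = k ∧ ∀ L : Line R, multiplicity K L.points ≤ n

/-- The multiset `K` of points is projective: every point has multiplicity `0` or `1`. -/
def IsProjective {R : Type*} [Ring R] (K : Point R → ℕ) : Prop :=
  ∀ x, K x = 0 ∨ K x = 1

/-- `m_n(R)`: the largest `k` for which a projective `(k, n)`-arc exists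
(see `isGreatest_maxArcSize`). -/
noncomputable def maxArcSize (R : Type*) [Ring R] (n : ℕ) : ℕ :=
  sSup {k : ℕ | ∃ K : Point R → ℕ, IsProjective K ∧ IsArc K k n}

/-- For a finite ring the supremum defining `m_n(R)` is attained. -/
theorem isGreatest_maxArcSize (R : Type*) [Ring R] [Finite R] (n : ℕ) :
    IsGreatest {k : ℕ | ∃ K : Point R → ℕ, IsProjective K ∧ IsArc K k n} (maxArcSize R n) := by
  classical
  have : Finite (Submodule Rᵐᵒᵖ (Fin 3 → R)) :=
    Finite.of_injective (fun N => (N : Set (Fin 3 → R))) SetLike.coe_injective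
  have : Finite (Point R) := Subtype.finite
  have := Fintype.ofFinite (Point R)
  have hne : {k : ℕ | ∃ K : Point R → ℕ, IsProjective K ∧ IsArc K k n}.Nonempty :=
    ⟨0, fun _ => 0, fun _ => Or.inl rfl, by simp [multiplicity], fun L => by simp [multiplicity]⟩
  have hbd : BddAbove {k : ℕ | ∃ K : Point R → ℕ, IsProjective K ∧ IsArc K k n} := by
    refine ⟨Fintype.card (Point R), ?_⟩
    rintro k ⟨K, hK, hk, -⟩
    rw [← hk, multiplicity, finsum_mem_univ, finsum_eq_sum_of_fintype]
    calc ∑ x, K x ≤ ∑ _x : Point R, 1 :=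
          Finset.sum_le_sum fun x _ => by rcases hK x with h | h <;> omega
      _ = Fintype.card (Point R) := by simp
  exact ⟨Nat.sSup_mem hne hbd, fun k hk => le_csSup hbd hk⟩

end PHG

open Finset Configuration

set_option linter.unusedSectionVars false

/-! Project the k points of an arc to the factor plane PG(2,q). Let u be the number of arc points in
a neighbour class of points, w the number in a neighbour class of lines `l`, and s the number in a
segment, that is, in a block of a point class in direction `l`. The q lines of `l` through a fixed
segment share that segment and partition the points of `l` outside its point class. As each line
holds at most 3 arc points, q s + w ≤ 3q + u. Summing over the q + 1 directions at a class gives k ≤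
2q² + 3q - (q - 1)u.

If some u ≥ 4, this is at most 2q² - q + 4. For odd q a further q is gained (u = 4, 5) or is not
needed (u ≥ 6). When segment sizes in some direction are not constant on the class, the sum for a
point in a smaller segment improves by q. Constant sizes are impossible for u = 5, and for u = 4
they would give a parallelogram with parallel diagonals, which forces characteristic 2.

If all u ≤ 3, the variance of w decides. Two points in one class determine a direction `l` with s ≥
2, so w ≤ q + u, far below 2q. No `l` is determined by two classes, since segments of size 2 in both
would put 4 points on a line. So the sum of (w - 2q)² over all `l` is large. That sum is an explicit
function of k and ∑ u², and comparing the two excludes k ≥ 2q² - 2q + 5. Only q = 5 with u = 3 needs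
more: w ≤ 11, because (n,3)-arcs in a plane of order five have n ≤ 11. -/

open scoped Classical in
/-- The number of elements of `X` lying over the point `a`. -/
noncomputable def classWeight {P X : Type*} [Fintype X] (p : X → P) (a : P) : ℕ :=
  #{x | p x = a}

open scoped Classical in
/-- The number of elements of `X` lying over points of the line `l`. -/
noncomputable def lineWeight {P L X : Type*} [Membership P L] [Fintype X] (p : X → P) (l : L) : ℕ :=
  #{x | p x ∈ l}

open scoped Classical in
/-- The number of elements of `X` in the segment through `x` in direction `l`; segments are the
level sets of `G l` in the fibres of `p`. -/
noncomputable def segmentWeight {P L X F : Type*} [Fintype X] (p : X → P) (G : L → X → F)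
    (l : L) (x : X) : ℕ :=
  #{y | p y = p x ∧ G l y = G l x}

/-! ### Double counting in a projective plane, and (n,3)-arcs in order five. -/

namespace Configuration.ProjectivePlane

variable {P L : Type*} [Membership P L] [Fintype P] [Fintype L] [ProjectivePlane P L]

open scoped Classical in
theorem card_lines_through (a : P) : #{l : L | a ∈ l} = order P L + 1 := by
  rw [← lineCount_eq (L := L) a, lineCount, Nat.card_eq_fintype_card, Fintype.card_subtype]

open scoped Classical in
theorem card_points_on (l : L) : #{a : P | a ∈ l} = order P L + 1 := by
  rw [← pointCount_eq P l, pointCount, Nat.card_eq_fintype_card, Fintype.card_subtype]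

open scoped Classical in
theorem card_lines_through_two {a b : P} (h : a ≠ b) : #{l : L | a ∈ l ∧ b ∈ l} = 1 := by
  obtain ⟨l, hl, hu⟩ := HasLines.existsUnique_line P L a b h
  rw [card_eq_one]
  exact ⟨l, by ext m; simpa using ⟨hu m, fun e => e ▸ hl⟩⟩

open scoped Classical in
theorem card_points_on_two {l m : L} (h : l ≠ m) : #{a : P | a ∈ l ∧ a ∈ m} = 1 := by
  obtain ⟨a, ha, hu⟩ := HasPoints.existsUnique_point P L l m h
  rw [card_eq_one]
  exact ⟨a, by ext m; simpa using ⟨hu m, fun e => e ▸ ha⟩⟩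

open scoped Classical in
theorem sum_lineWeight_through {X : Type*} [Fintype X] (p : X → P) (a : P) :
    ∑ l : L with a ∈ l, lineWeight p l = Fintype.card X + order P L * classWeight p a := by
  calc ∑ l : L with a ∈ l, lineWeight p l
      = ∑ l : L with a ∈ l, ∑ x : X, if p x ∈ l then 1 else 0 := by
        simp [lineWeight]
    _ = ∑ x : X, ∑ l : L with a ∈ l, if p x ∈ l then 1 else 0 := sum_comm
    _ = ∑ x : X, (1 + order P L * if p x = a then 1 else 0) := by
        refine sum_congr rfl fun x _ => ?_
        rw [sum_boole, filter_filter]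
        split_ifs with h
        · simp [h, card_lines_through, add_comm]
        · rw [card_lines_through_two (Ne.symm h)]; simp
    _ = _ := by
        rw [sum_add_distrib, ← mul_sum]; simp [classWeight]

open scoped Classical in
theorem sum_lineWeight_mul {X : Type*} [Fintype X] (p : X → P) (f : L → ℕ) :
    ∑ l : L, lineWeight p l * f l = ∑ x : X, ∑ l : L with p x ∈ l, f l := by
  simp_rw [sum_filter]
  rw [sum_comm]
  refine sum_congr rfl fun l _ => ?_
  rw [← sum_filter, sum_const, lineWeight, smul_eq_mul]

theorem sum_lineWeight {X : Type*} [Fintype X] (p : X → P) :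
    ∑ l : L, lineWeight p l = Fintype.card X * (order P L + 1) := by
  classical
  have := sum_lineWeight_mul (L := L) p (fun _ => 1)
  simpa [card_lines_through] using this

theorem sum_classWeight {X : Type*} [Fintype X] (p : X → P) :
    ∑ a, classWeight p a = Fintype.card X := by
  classical
  exact (card_eq_sum_card_fiberwise (f := p) (s := univ) (t := univ) (by simp)).symm

theorem sum_classWeight_sq {X : Type*} [Fintype X] (p : X → P) :
    ∑ a, classWeight p a ^ 2 = ∑ x, classWeight p (p x) := by
  classical
  rw [← sum_fiberwise univ p]
  refine sum_congr rfl fun a _ => ?_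
  rw [sum_congr rfl (g := fun _ => classWeight p a)
    (fun x hx => by rw [(mem_filter.1 hx).2]), sum_const, smul_eq_mul, sq, classWeight]

theorem sum_lineWeight_sq {X : Type*} [Fintype X] (p : X → P) :
    ∑ l : L, lineWeight p l ^ 2 =
      Fintype.card X ^ 2 + order P L * ∑ a, classWeight p a ^ 2 := by
  classical
  simp_rw [sq (lineWeight p _)]
  rw [sum_lineWeight_mul]
  simp_rw [sum_lineWeight_through]
  rw [sum_add_distrib, ← mul_sum, sum_classWeight_sq]
  simp [sq]

open scoped Classical in
/-- A set of points of a projective plane of order five with at most three points on every line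
has at most eleven points. -/
theorem card_le_eleven_of_order_eq_five (h5 : order P L = 5) (A : Finset P)
    (hA : ∀ l : L, #{a ∈ A | a ∈ l} ≤ 3) : #A ≤ 11 := by
  by_contra! hcard
  obtain ⟨B, hBA, hB⟩ := exists_subset_card_eq (show 12 ≤ #A from hcard)
  set m : L → ℕ := fun l => lineWeight (Subtype.val : B → P) l with hm
  have hm' : ∀ l, m l = #{a ∈ B | a ∈ l} := fun l => by
    simp only [hm, lineWeight]
    rw [← card_map (Function.Embedding.subtype _)]
    congr 1
    ext a
    simp [and_comm]
  have hm3 : ∀ l, m l ≤ 3 := fun l => by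
    rw [hm']
    exact (card_le_card (filter_subset_filter _ hBA)).trans (hA l)
  have hw : ∀ a : P, classWeight (Subtype.val : B → P) a = if a ∈ B then 1 else 0 := fun a => by
    rw [classWeight]
    split_ifs with h
    · rw [card_eq_one]; exact ⟨⟨a, h⟩, by ext x; simp [Subtype.ext_iff]⟩
    · rw [card_eq_zero, filter_eq_empty_iff]
      rintro ⟨x, hx⟩ - rfl
      exact h hx
  have hsum : ∀ a : P, ∑ l : L with a ∈ l, m l = 12 + 5 * if a ∈ B then 1 else 0 := fun a => by
    rw [sum_lineWeight_through, hw, h5, Fintype.card_coe, hB]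
  -- The six lines through a point of `B` carry 12 + 5 = 17 incidences out of 6 · 3 = 18. So exactly
  -- one of them is a 2-secant and the others are 3-secants; there are no tangents.
  have hmem : ∀ a ∈ B, ∑ l : L with a ∈ l, (3 - m l) = 1 := fun a ha => by
    have h1 := hsum a
    have h2 : ∑ l : L with a ∈ l, ((3 - m l) + m l) = 18 := by
      rw [sum_congr rfl (fun l _ => Nat.sub_add_cancel (hm3 l)), sum_const, card_lines_through, h5]
      rfl
    rw [sum_add_distrib, h1, if_pos ha] at h2
    omega
  have hmem2 : ∀ a ∈ B, ∀ l : L, a ∈ l → 2 ≤ m l := fun a ha l hl => by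
    have := single_le_sum (f := fun l => 3 - m l) (fun _ _ => Nat.zero_le _)
      (show l ∈ ({l : L | a ∈ l} : Finset L) by simpa using hl)
    have := hmem a ha
    have := hm3 l
    grind
  have hval : ∀ l, m l = 0 ∨ m l = 2 ∨ m l = 3 := fun l => by
    by_cases h : ∃ a ∈ B, a ∈ l
    · obtain ⟨a, ha, hl⟩ := h
      have := hmem2 a ha l hl
      have := hm3 l
      omega
    · left
      rw [hm', card_eq_zero, filter_eq_empty_iff]
      exact fun a ha hl => h ⟨a, ha, hl⟩
  set f : L → ℕ := fun l => if m l = 2 then 1 else 0 with hf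
  have hf1 : ∀ a ∈ B, ∑ l : L with a ∈ l, f l = 1 := fun a ha => by
    rw [← hmem a ha]
    refine sum_congr rfl fun l hl => ?_
    have := hmem2 a ha l (mem_filter.1 hl).2
    have := hm3 l
    simp only [hf]
    split_ifs <;> omega
  -- Adding 1 to each 2-secant turns the total 12 into a multiple of 3.
  have hf3 : ∀ a ∉ B, 3 ∣ ∑ l : L with a ∈ l, f l := fun a ha => by
    have h1 := hsum a
    rw [if_neg ha] at h1
    have h2 : ∑ l : L with a ∈ l, m l + ∑ l : L with a ∈ l, f l =
        3 * ∑ l : L with a ∈ l, (if m l = 0 then 0 else 1) := by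
      rw [← sum_add_distrib, mul_sum]
      refine sum_congr rfl fun l _ => ?_
      simp only [hf]
      rcases hval l with h | h | h <;> simp [h]
    omega
  have hT : ∑ l, f l = 6 := by
    have h1 := sum_lineWeight_mul (Subtype.val : B → P) f
    rw [sum_congr rfl (fun (x : B) _ => hf1 x.1 x.2)] at h1
    have h2 : ∑ l, m l * f l = 2 * ∑ l, f l := by
      rw [mul_sum]
      refine sum_congr rfl fun l _ => ?_
      simp only [hf]
      split_ifs with h <;> simp [h]
    rw [h2] at h1
    simp [hB] at h1
    omega
  obtain ⟨a, ha⟩ : B.Nonempty := by rw [← card_pos]; omega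
  obtain ⟨l₀, hl₀, hfl⟩ : ∃ l₀ ∈ ({l : L | a ∈ l} : Finset L), f l₀ ≠ 0 :=
    exists_ne_zero_of_sum_ne_zero (by rw [hf1 a ha]; exact one_ne_zero)
  have hfl1 : f l₀ = 1 := by simp only [hf] at hfl ⊢; split_ifs at hfl ⊢ <;> simp_all
  have hm2 : m l₀ = 2 := by simp only [hf] at hfl; split_ifs at hfl <;> simp_all
  -- Each of the four points of the 2-secant `l₀` outside `B` is on at least three 2-secants.
  -- Counted along `l₀` this needs 4 · 3 + 2 · 1 = 14 incidences, but the six 2-secants supply only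
  -- 6 + 5 = 11.
  have hle : ∀ b : P, b ∈ l₀ →
      3 ≤ (∑ l : L with b ∈ l, f l) + 2 * if b ∈ B then 1 else 0 := fun b hb => by
    split_ifs with h
    · rw [hf1 b h]
    · have h1 := single_le_sum (f := f) (fun _ _ => Nat.zero_le _)
        (show l₀ ∈ ({l : L | b ∈ l} : Finset L) by simpa using hb)
      have := hf3 b h
      omega
  have htot : ∑ b : P with b ∈ l₀, ∑ l : L with b ∈ l, f l = 11 := by
    simp_rw [sum_filter (fun l : L => _ ∈ l)]
    rw [sum_comm]
    have : ∀ l : L, ∑ b : P with b ∈ l₀, (if b ∈ l then f l else 0) =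
        f l + if l = l₀ then 5 else 0 := fun l => by
      rw [← sum_filter, filter_filter, sum_const, smul_eq_mul]
      split_ifs with h
      · subst h; simp [card_points_on, h5, hfl1]
      · rw [card_points_on_two (Ne.symm h)]; simp
    rw [sum_congr rfl fun l _ => this l, sum_add_distrib, hT]
    simp
  have hfin := sum_le_sum (s := ({b : P | b ∈ l₀} : Finset P)) fun b hb => hle b (mem_filter.1 hb).2
  rw [sum_add_distrib, htot, ← mul_sum, sum_const, card_points_on, h5, ← sum_filter, filter_filter,
    sum_const] at hfin
  have : #{b : P | b ∈ l₀ ∧ b ∈ B} = 2 := by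
    rw [← hm2, hm']
    congr 1
    ext b
    simp [and_comm]
  simp [this] at hfin

end Configuration.ProjectivePlane

open ProjectivePlane in
/-- The combinatorial properties of the set of points of an arc with line multiplicities at most
three in a projective Hjelmslev plane with factor plane `(P, L)`: the map `p` sends a point to its
neighbour class, and the level sets of `G l` in a class are the segments in direction `l`. -/
structure IsHjelmslevTriarc {P L X F : Type*} [Membership P L] [ProjectivePlane P L] [Fintype X]
    (p : X → P) (G : L → X → F) : Prop where
  segmentWeight_add_le : ∀ l x y, p x ∈ l → p y ∈ l → p x ≠ p y →
    segmentWeight p G l x + segmentWeight p G l y ≤ 3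
  mul_segmentWeight_add_le : ∀ l x, p x ∈ l →
    order P L * segmentWeight p G l x + lineWeight p l ≤ 3 * order P L + classWeight p (p x)
  existsUnique_line : ∀ x y, x ≠ y → p x = p y → ∃! l, p x ∈ l ∧ G l x = G l y
  eq_of_parallelogram : Odd (order P L) → ∀ x₁ x₂ x₃ x₄ l₂ l₃ l₄,
    p x₁ = p x₂ → p x₁ = p x₃ → p x₁ = p x₄ → p x₁ ∈ l₂ → p x₁ ∈ l₃ → p x₁ ∈ l₄ → l₂ ≠ l₃ →
    G l₂ x₁ = G l₂ x₂ → G l₂ x₃ = G l₂ x₄ → G l₃ x₁ = G l₃ x₃ → G l₃ x₂ = G l₃ x₄ →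
    G l₄ x₁ = G l₄ x₄ → G l₄ x₂ = G l₄ x₃ → G l₄ x₁ = G l₄ x₂
  lineWeight_le_eleven : order P L = 5 → ∀ l,
    (∀ x y, p x ∈ l → p x = p y → G l x = G l y → x = y) → (∀ a, classWeight p a ≤ 3) →
    lineWeight p l ≤ 11

/-! ### Point classes with at least four arc points. -/

namespace IsHjelmslevTriarc

open ProjectivePlane

variable {P L X F : Type*} [Membership P L] [ProjectivePlane P L] [Fintype P] [Fintype L]
  [Fintype X] {p : X → P} {G : L → X → F}

theorem two_le_segmentWeight {l : L} {x y : X} (hxy : x ≠ y) (hp : p x = p y)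
    (hG : G l x = G l y) : 2 ≤ segmentWeight p G l x := by
  classical
  rw [← card_pair hxy]
  exact card_le_card fun z hz => by
    rcases mem_insert.1 hz with rfl | h
    · simp
    · rw [mem_singleton.1 h]; simp [hp, hG]

theorem three_le_segmentWeight {l : L} {x y z : X} (hxy : x ≠ y) (hxz : x ≠ z) (hyz : y ≠ z)
    (hpy : p x = p y) (hpz : p x = p z) (hy : G l x = G l y) (hz : G l x = G l z) :
    3 ≤ segmentWeight p G l x := by
  classical
  rw [← card_eq_three.2 ⟨x, y, z, hxy, hxz, hyz, rfl⟩]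
  exact card_le_card fun t ht => by
    simp only [mem_insert, mem_singleton] at ht
    rcases ht with rfl | rfl | rfl
    · simp
    · simp [hpy, hy]
    · simp [← hpz, ← hz]

-- Each other point of the class shares a segment with `x` in exactly one direction, while `x`
-- itself is counted in all q + 1.
open scoped Classical in
theorem sum_segmentWeight (h : IsHjelmslevTriarc p G) (x : X) :
    ∑ l : L with p x ∈ l, segmentWeight p G l x = order P L + classWeight p (p x) := by
  calc ∑ l : L with p x ∈ l, segmentWeight p G l x
      = ∑ l : L with p x ∈ l, ∑ y : X with p y = p x, if G l y = G l x then 1 else 0 := by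
        simp [segmentWeight, filter_filter]
    _ = ∑ y : X with p y = p x, ∑ l : L with p x ∈ l, if G l y = G l x then 1 else 0 := sum_comm
    _ = ∑ y : X with p y = p x, (1 + if y = x then order P L else 0) := by
        refine sum_congr rfl fun y hy => ?_
        rw [sum_boole, filter_filter]
        split_ifs with e
        · simp [e, card_lines_through, add_comm]
        · obtain ⟨l, hl, hu⟩ := h.existsUnique_line x y (Ne.symm e) (mem_filter.1 hy).2.symm
          rw [add_zero, Nat.cast_id, card_eq_one]
          exact ⟨l, by ext m; simpa [eq_comm] using
            ⟨fun ⟨h1, h2⟩ => (hu m ⟨h1, h2⟩).symm, fun e => e ▸ hl⟩⟩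
    _ = _ := by
        rw [sum_add_distrib]; simp [classWeight, add_comm]

theorem card_add_le (h : IsHjelmslevTriarc p G) (x : X) :
    Fintype.card X + order P L * classWeight p (p x) ≤
      2 * order P L ^ 2 + 3 * order P L + classWeight p (p x) := by
  classical
  have h1 := sum_le_sum (s := ({l : L | p x ∈ l} : Finset L)) fun l hl =>
    h.mul_segmentWeight_add_le l x (mem_filter.1 hl).2
  rw [sum_add_distrib, ← mul_sum, h.sum_segmentWeight, sum_lineWeight_through, sum_const,
    card_lines_through, smul_eq_mul] at h1
  nlinarith

/-- In direction `l₀` the bound is taken at the larger segment of `y`, which saves q in the sum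
formed at `x`. -/
theorem card_add_le_of_lt (h : IsHjelmslevTriarc p G) {x y : X} {l₀ : L} (hx : p x ∈ l₀)
    (hxy : p x = p y) (hlt : segmentWeight p G l₀ x < segmentWeight p G l₀ y) :
    Fintype.card X + order P L * classWeight p (p x) + order P L ≤
      2 * order P L ^ 2 + 3 * order P L + classWeight p (p x) := by
  classical
  have h1 : ∀ l ∈ ({l : L | p x ∈ l} : Finset L),
      order P L * (segmentWeight p G l x + if l = l₀ then 1 else 0) + lineWeight p l ≤
        3 * order P L + classWeight p (p x) := fun l hl => by
    split_ifs with e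
    · subst e
      have := h.mul_segmentWeight_add_le l y (hxy ▸ hx)
      rw [← hxy] at this
      exact (Nat.add_le_add_right (Nat.mul_le_mul_left _ hlt) _).trans this
    · exact h.mul_segmentWeight_add_le l x (mem_filter.1 hl).2
  have h2 := sum_le_sum h1
  rw [sum_add_distrib, ← mul_sum, sum_add_distrib, h.sum_segmentWeight, sum_lineWeight_through,
    sum_const, card_lines_through, smul_eq_mul] at h2
  simp only [sum_ite_eq', mem_filter, mem_univ, true_and, hx, if_true] at h2
  nlinarith

theorem card_le_of_four_le (h : IsHjelmslevTriarc p G) {x : X} (hx : 4 ≤ classWeight p (p x)) :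
    Fintype.card X + order P L ≤ 2 * order P L ^ 2 + 4 := by
  have h1 := h.card_add_le x
  have := one_lt_order P L
  nlinarith

/-- Segments of constant size divide a class into parts of equal size. -/
theorem segmentWeight_dvd_classWeight {x : X} {l : L}
    (hc : ∀ y, p x = p y → segmentWeight p G l y = segmentWeight p G l x) :
    segmentWeight p G l x ∣ classWeight p (p x) := by
  classical
  rw [classWeight, card_eq_sum_card_image (G l)]
  refine dvd_sum fun b hb => ?_
  obtain ⟨y, hy, rfl⟩ := mem_image.1 hb
  have hy' := (mem_filter.1 hy).2
  rw [← hc y hy'.symm, segmentWeight, filter_filter, hy']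

theorem segmentWeight_le_three (h : IsHjelmslevTriarc p G) {x : X} {l : L} (hx : p x ∈ l) :
    segmentWeight p G l x ≤ 3 := by
  classical
  have h1 := h.mul_segmentWeight_add_le l x hx
  have h2 : classWeight p (p x) ≤ lineWeight p l :=
    card_le_card fun y hy => by simpa [(mem_filter.1 hy).2] using hx
  have h3 := one_lt_order P L
  by_contra! h4
  nlinarith

/-- Constant segment sizes would divide 5 and be at most 3, hence all equal 1. Their sum over the
directions would be q + 1 instead of q + 5. -/
theorem exists_lt_of_classWeight_eq_five (h : IsHjelmslevTriarc p G) {x : X}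
    (hx : classWeight p (p x) = 5) : ∃ y z l, p y = p x ∧ p z = p x ∧ p x ∈ l ∧
      segmentWeight p G l y < segmentWeight p G l z := by
  classical
  by_contra! hcon
  have hone : ∀ l ∈ ({l : L | p x ∈ l} : Finset L), segmentWeight p G l x = 1 := fun l hl => by
    have hl' := (mem_filter.1 hl).2
    have hd := segmentWeight_dvd_classWeight (p := p) (G := G) (x := x) (l := l) fun y hy =>
      le_antisymm (hcon x y l rfl hy.symm hl') (hcon y x l hy.symm rfl hl')
    rw [hx, Nat.dvd_prime Nat.prime_five] at hd
    have := h.segmentWeight_le_three hl'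
    omega
  have hs := h.sum_segmentWeight x
  rw [sum_congr rfl hone, sum_const, card_lines_through, hx, smul_eq_mul] at hs
  omega

/-- Constant sizes would be 1 or 2, so each direction joining two of the four points also joins the
other two. This is a parallelogram with parallel diagonals, which `eq_of_parallelogram` excludes for
odd order. -/
theorem exists_lt_of_classWeight_eq_four (h : IsHjelmslevTriarc p G) (hq : Odd (order P L)) {x : X}
    (hx : classWeight p (p x) = 4) : ∃ y z l, p y = p x ∧ p z = p x ∧ p x ∈ l ∧
      segmentWeight p G l y < segmentWeight p G l z := by
  classical
  by_contra! hcon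
  have hconst : ∀ l, p x ∈ l → ∀ y, p x = p y → segmentWeight p G l y = segmentWeight p G l x :=
    fun l hl y hy => le_antisymm (hcon x y l rfl hy.symm hl) (hcon y x l hy.symm rfl hl)
  have htwo : ∀ l, p x ∈ l → segmentWeight p G l x ≤ 2 := fun l hl => by
    have hd := segmentWeight_dvd_classWeight (hconst l hl)
    have := h.segmentWeight_le_three hl
    rw [hx] at hd
    interval_cases segmentWeight p G l x <;> omega
  have hnot3 : ∀ l, p x ∈ l → ∀ y z t, y ≠ z → y ≠ t → z ≠ t → p x = p y → p x = p z →
      p x = p t → G l y = G l z → G l y = G l t → False := fun l hl y z t h1 h2 h3 hy hz ht e1 e2 => by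
    have := three_le_segmentWeight (p := p) h1 h2 h3 (hy ▸ hz) (hy ▸ ht) e1 e2
    have := htwo l hl
    have := hconst l hl y hy
    omega
  have hclass := hx
  rw [classWeight, card_eq_succ] at hclass
  obtain ⟨a, s, has, hs, hcard⟩ := hclass
  obtain ⟨b, c, d, hbc, hbd, hcd, rfl⟩ := card_eq_three.1 hcard
  simp only [mem_insert, mem_singleton, not_or] at has
  obtain ⟨hab, hac, had⟩ := has
  have hmem : ∀ y, p y = p x ↔ y = a ∨ y = b ∨ y = c ∨ y = d := fun y => by
    have := Finset.ext_iff.1 hs y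
    simp only [mem_insert, mem_singleton, mem_filter, mem_univ, true_and] at this
    exact this.symm
  have ha : p x = p a := ((hmem a).2 (by simp)).symm
  have hb : p x = p b := ((hmem b).2 (by simp)).symm
  have hc : p x = p c := ((hmem c).2 (by simp)).symm
  have hd : p x = p d := ((hmem d).2 (by simp)).symm
  have hpair : ∀ y z t u, y ≠ z → y ≠ t → y ≠ u → z ≠ t → z ≠ u → t ≠ u → p x = p y → p x = p z →
      p x = p t → p x = p u → (∀ w, p w = p x → w = y ∨ w = z ∨ w = t ∨ w = u) →
      ∀ l, p x ∈ l → G l y = G l z → G l t = G l u := by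
    intro y z t u hyz hyt hyu hzt hzu htu hy hz ht hu hall l hl e
    have h2 : 2 ≤ segmentWeight p G l t := by
      rw [hconst l hl t ht, ← hconst l hl y hy]
      exact two_le_segmentWeight hyz (hy ▸ hz) e
    obtain ⟨w, hw, hwt⟩ := exists_mem_ne (show 1 < _ from h2) t
    obtain ⟨hw1, hw2⟩ := (mem_filter.1 hw).2
    rcases hall w (hw1.trans ht.symm) with rfl | rfl | rfl | rfl
    · exact (hnot3 l hl w z t hyz hyt hzt hy hz ht e hw2).elim
    · exact (hnot3 l hl w y t hyz.symm hzt hyt hz hy ht e.symm hw2).elim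
    · exact (hwt rfl).elim
    · exact hw2.symm
  obtain ⟨l₂, ⟨hl₂, e₂⟩, -⟩ := h.existsUnique_line a b hab (ha ▸ hb)
  obtain ⟨l₃, ⟨hl₃, e₃⟩, -⟩ := h.existsUnique_line a c hac (ha ▸ hc)
  obtain ⟨l₄, ⟨hl₄, e₄⟩, -⟩ := h.existsUnique_line a d had (ha ▸ hd)
  rw [← ha] at hl₂ hl₃ hl₄
  have f₂ := hpair a b c d hab hac had hbc hbd hcd ha hb hc hd (fun w => (hmem w).1) l₂ hl₂ e₂
  have f₃ := hpair a c b d hac hab had hbc.symm hcd hbd ha hc hb hd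
    (fun w hw => by have := (hmem w).1 hw; tauto) l₃ hl₃ e₃
  have f₄ := hpair a d b c had hab hac hbd.symm hcd.symm hbc ha hd hb hc
    (fun w hw => by have := (hmem w).1 hw; tauto) l₄ hl₄ e₄
  have hne : l₂ ≠ l₃ := fun e => by
    subst e
    exact hnot3 l₂ hl₂ a b c hab hac hbc ha hb hc e₂ e₃
  have := h.eq_of_parallelogram hq a b c d l₂ l₃ l₄ (ha ▸ hb) (ha ▸ hc) (ha ▸ hd) (ha ▸ hl₂)
    (ha ▸ hl₃) (ha ▸ hl₄) hne e₂ f₂ e₃ f₃ e₄ f₄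
  exact hnot3 l₄ hl₄ a b d hab had hbd ha hb hd this e₄

theorem card_le_of_four_le_of_odd (h : IsHjelmslevTriarc p G) (hq : Odd (order P L)) {x : X}
    (hx : 4 ≤ classWeight p (p x)) :
    Fintype.card X + 2 * order P L ≤ 2 * order P L ^ 2 + 4 := by
  have h1 := one_lt_order P L
  by_cases h6 : 6 ≤ classWeight p (p x)
  · have := h.card_add_le x
    nlinarith
  · obtain ⟨y, z, l, hy, hz, hl, hlt⟩ : ∃ y z l, p y = p x ∧ p z = p x ∧ p x ∈ l ∧
        segmentWeight p G l y < segmentWeight p G l z := by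
      rcases (show classWeight p (p x) = 4 ∨ classWeight p (p x) = 5 by omega) with e | e
      · exact h.exists_lt_of_classWeight_eq_four hq e
      · exact h.exists_lt_of_classWeight_eq_five e
    have := h.card_add_le_of_lt (hy ▸ hl) (hy.trans hz.symm) hlt
    rw [hy] at this
    nlinarith

end IsHjelmslevTriarc

/-! ### Point classes of size at most three: the variance argument. -/

namespace IsHjelmslevTriarc

open ProjectivePlane

variable {P L X F : Type*} [Membership P L] [ProjectivePlane P L] [Fintype P] [Fintype L]
  [Fintype X] {p : X → P} {G : L → X → F}

open scoped Classical in
/-- The lines through `a` whose direction is determined by two elements of the class of `a`. -/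
noncomputable def determinedLines (p : X → P) (G : L → X → F) (a : P) : Finset L :=
  {l | a ∈ l ∧ ∃ x, p x = a ∧ 2 ≤ segmentWeight p G l x}

theorem mem_determinedLines {a : P} {l : L} :
    l ∈ determinedLines p G a ↔ a ∈ l ∧ ∃ x, p x = a ∧ 2 ≤ segmentWeight p G l x := by
  simp [determinedLines]

theorem mem_determinedLines_of_eq {l : L} {x y : X} (hxy : x ≠ y) (hp : p x = p y) (hx : p x ∈ l)
    (hG : G l x = G l y) : l ∈ determinedLines p G (p x) :=
  mem_determinedLines.2 ⟨hx, x, rfl, two_le_segmentWeight hxy hp hG⟩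

theorem eq_of_mem_determinedLines (h : IsHjelmslevTriarc p G) {a b : P} {l : L}
    (ha : l ∈ determinedLines p G a) (hb : l ∈ determinedLines p G b) : a = b := by
  obtain ⟨hal, x, rfl, hx⟩ := mem_determinedLines.1 ha
  obtain ⟨hbl, y, rfl, hy⟩ := mem_determinedLines.1 hb
  by_contra hne
  have := h.segmentWeight_add_le l x y hal hbl hne
  omega

theorem lineWeight_le_of_mem_determinedLines (h : IsHjelmslevTriarc p G) {a : P} {l : L}
    (ha : l ∈ determinedLines p G a) : lineWeight p l ≤ order P L + classWeight p a := by
  obtain ⟨hal, x, rfl, hx⟩ := mem_determinedLines.1 ha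
  have := h.mul_segmentWeight_add_le l x hal
  nlinarith

theorem lineWeight_le_eleven_of_classWeight_le (h : IsHjelmslevTriarc p G) (h5 : order P L = 5)
    (hw : ∀ a, classWeight p a ≤ 3) (l : L) : lineWeight p l ≤ 11 := by
  by_cases hl : ∃ a, l ∈ determinedLines p G a
  · obtain ⟨a, ha⟩ := hl
    have := h.lineWeight_le_of_mem_determinedLines ha
    have := hw a
    omega
  · refine h.lineWeight_le_eleven h5 l (fun x y hx hp hG => ?_) hw
    by_contra hxy
    exact hl ⟨_, mem_determinedLines_of_eq hxy hp hx hG⟩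

/-- The squared deviation of the weight of a line from twice the order of the plane. -/
noncomputable def deficiencySq (p : X → P) (l : L) : ℤ :=
  ((lineWeight p l : ℤ) - 2 * order P L) ^ 2

theorem sq_le_deficiencySq {l : L} {c : ℕ} (hl : lineWeight p l ≤ c) (hc : c ≤ 2 * order P L) :
    (2 * (order P L : ℤ) - c) ^ 2 ≤ deficiencySq p l := by
  have h1 : (lineWeight p l : ℤ) ≤ c := by exact_mod_cast hl
  have h2 : (c : ℤ) ≤ 2 * order P L := by exact_mod_cast hc
  rw [deficiencySq]
  nlinarith

theorem sum_deficiencySq (p : X → P) :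
    ∑ l : L, deficiencySq p l = (Fintype.card X : ℤ) ^ 2 +
      order P L * ∑ a, (classWeight p a : ℤ) ^ 2
      - 4 * order P L * (order P L + 1) * Fintype.card X
      + 4 * (order P L : ℤ) ^ 2 * ((order P L : ℤ) ^ 2 + order P L + 1) := by
  have h1 : ∑ l : L, (lineWeight p l : ℤ) ^ 2 = (Fintype.card X : ℤ) ^ 2 +
      order P L * ∑ a, (classWeight p a : ℤ) ^ 2 := by
    exact_mod_cast sum_lineWeight_sq (L := L) p
  have h2 : ∑ l : L, (lineWeight p l : ℤ) = Fintype.card X * (order P L + 1) := by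
    exact_mod_cast sum_lineWeight (L := L) p
  have h3 : (Fintype.card L : ℤ) = (order P L : ℤ) ^ 2 + order P L + 1 := by
    exact_mod_cast card_lines P L
  calc ∑ l : L, deficiencySq p l
      = ∑ l : L, ((lineWeight p l : ℤ) ^ 2 - 4 * order P L * lineWeight p l
          + 4 * (order P L : ℤ) ^ 2) := sum_congr rfl fun l _ => by rw [deficiencySq]; ring
    _ = _ := by
        rw [sum_add_distrib, sum_sub_distrib, ← mul_sum, h1, h2, sum_const, card_univ, nsmul_eq_mul,
          h3]
        ring

theorem sum_determinedLines_le (h : IsHjelmslevTriarc p G) :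
    ∑ a, ∑ l ∈ determinedLines p G a, deficiencySq p l ≤ ∑ l : L, deficiencySq p l := by
  classical
  rw [← sum_biUnion]
  · exact sum_le_sum_of_subset_of_nonneg (subset_univ _) fun l _ _ => sq_nonneg _
  · intro a _ b _ hab
    rw [Function.onFun, disjoint_left]
    exact fun l hla hlb => hab (h.eq_of_mem_determinedLines hla hlb)

theorem classWeight_three_bound (h : IsHjelmslevTriarc p G)
    (hq : order P L = 5 ∨ 7 ≤ order P L) (hw : ∀ a, classWeight p a ≤ 3)
    (hk : 2 * order P L ^ 2 + 5 ≤ Fintype.card X + 2 * order P L) {a : P}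
    (ha : classWeight p a = 3) :
    6 * (order P L : ℤ) ≤ ∑ l ∈ determinedLines p G a, deficiencySq p l := by
  classical
  have hq5 : (5 : ℤ) ≤ order P L := by have : 5 ≤ order P L := by omega
                                       exact_mod_cast this
  have hnn : ∀ l ∈ determinedLines p G a, 0 ≤ deficiencySq p l := fun l _ => sq_nonneg _
  have hfew : ∀ (l : L) (x : X), p x = a → a ∈ l → 3 ≤ segmentWeight p G l x →
      6 * (order P L : ℤ) ≤ ∑ l ∈ determinedLines p G a, deficiencySq p l := by
    rintro l x rfl hl hs
    have h1 := h.mul_segmentWeight_add_le l x hl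
    have h2 : lineWeight p l ≤ 3 := by rw [ha] at h1; nlinarith
    refine le_trans ?_ (single_le_sum hnn (mem_determinedLines.2 ⟨hl, x, rfl, by omega⟩))
    refine le_trans ?_ (sq_le_deficiencySq h2 (by omega))
    push_cast
    nlinarith
  have hclass := ha
  rw [classWeight, card_eq_three] at hclass
  obtain ⟨x, y, z, hxy, hxz, hyz, hs⟩ := hclass
  have hmem : ∀ t, t = x ∨ t = y ∨ t = z → p t = a := fun t ht => by
    have := Finset.ext_iff.1 hs t
    simp only [mem_insert, mem_singleton, mem_filter, mem_univ, true_and] at this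
    exact this.2 ht
  have hx := hmem x (by simp)
  have hy := hmem y (by simp)
  have hz := hmem z (by simp)
  obtain ⟨l₁, ⟨hl₁, e₁⟩, -⟩ := h.existsUnique_line x y hxy (hx.trans hy.symm)
  obtain ⟨l₂, ⟨hl₂, e₂⟩, -⟩ := h.existsUnique_line x z hxz (hx.trans hz.symm)
  obtain ⟨l₃, ⟨hl₃, e₃⟩, -⟩ := h.existsUnique_line y z hyz (hy.trans hz.symm)
  by_cases h12 : l₁ = l₂
  · subst h12
    exact hfew l₁ x hx (hx ▸ hl₁) (three_le_segmentWeight hxy hxz hyz (hx.trans hy.symm)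
      (hx.trans hz.symm) e₁ e₂)
  by_cases h13 : l₁ = l₃
  · subst h13
    exact hfew l₁ x hx (hx ▸ hl₁) (three_le_segmentWeight hxy hxz hyz (hx.trans hy.symm)
      (hx.trans hz.symm) e₁ (e₁.trans e₃))
  by_cases h23 : l₂ = l₃
  · subst h23
    exact hfew l₂ x hx (hx ▸ hl₂) (three_le_segmentWeight hxy hxz hyz (hx.trans hy.symm)
      (hx.trans hz.symm) (e₂.trans e₃.symm) e₂)
  have hm₁ : l₁ ∈ determinedLines p G a :=
    hx ▸ mem_determinedLines_of_eq hxy (hx.trans hy.symm) hl₁ e₁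
  have hm₂ : l₂ ∈ determinedLines p G a :=
    hx ▸ mem_determinedLines_of_eq hxz (hx.trans hz.symm) hl₂ e₂
  have hm₃ : l₃ ∈ determinedLines p G a :=
    hy ▸ mem_determinedLines_of_eq hyz (hy.trans hz.symm) hl₃ e₃
  have hsub : ({l₁, l₂, l₃} : Finset L) ⊆ determinedLines p G a := by
    simp [insert_subset_iff, hm₁, hm₂, hm₃]
  have hcard3 : #({l₁, l₂, l₃} : Finset L) = 3 := card_eq_three.2 ⟨_, _, _, h12, h13, h23, rfl⟩
  -- For q = 5 the three determined lines through `a` have weight at most 8 and the other three at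
  -- most 11. So k + 15 ≤ 57, below the assumed k ≥ 45. For q ≥ 7 the three squares suffice: 3(q -
  -- 3)² ≥ 6q, which fails at q = 5.
  rcases hq with h5 | h7
  · exfalso
    have hline : ∀ l ∈ ({l : L | a ∈ l} : Finset L),
        lineWeight p l + 3 * (if l ∈ ({l₁, l₂, l₃} : Finset L) then 1 else 0) ≤ 11 := fun l _ => by
      split_ifs with hl
      · have := h.lineWeight_le_of_mem_determinedLines (hsub hl)
        omega
      · have := h.lineWeight_le_eleven_of_classWeight_le h5 hw l
        omega
    have hs := sum_le_sum hline
    rw [sum_add_distrib, sum_lineWeight_through, ← mul_sum, sum_const, card_lines_through, h5, ha,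
      sum_boole, filter_filter] at hs
    have hc : #{l : L | a ∈ l ∧ l ∈ ({l₁, l₂, l₃} : Finset L)} = 3 := by
      rw [← hcard3]
      congr 1
      ext l
      simp only [mem_filter, mem_univ, true_and, and_iff_right_iff_imp]
      exact fun hl => (mem_determinedLines.1 (hsub hl)).1
    rw [hc] at hs
    rw [h5] at hk
    norm_num at hs hk
    omega
  · have h7' : (7 : ℤ) ≤ order P L := by exact_mod_cast h7
    have hbound : ∀ l ∈ ({l₁, l₂, l₃} : Finset L),
        ((order P L : ℤ) - 3) ^ 2 ≤ deficiencySq p l := fun l hl => by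
      have h1 := h.lineWeight_le_of_mem_determinedLines (hsub hl)
      rw [ha] at h1
      have h2 := sq_le_deficiencySq h1 (by omega)
      push_cast at h2
      linarith [show (2 * (order P L : ℤ) - (order P L + 3)) = order P L - 3 by ring]
    have h1 := card_nsmul_le_sum _ _ _ hbound
    rw [hcard3, nsmul_eq_mul] at h1
    refine le_trans ?_ (sum_le_sum_of_subset_of_nonneg hsub fun l hl _ => hnn l hl)
    refine le_trans ?_ h1
    push_cast
    nlinarith

/-- The coefficient 2q is chosen so that ∑ u² cancels against `sum_deficiencySq` after summation
over `a`. The slack u on the right is needed when q = 5 and u = 2, where 20 ≤ 2 · 9 + 2 is an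
equality. -/
theorem classWeight_bound (h : IsHjelmslevTriarc p G)
    (hq : order P L = 5 ∨ 7 ≤ order P L) (hw : ∀ a, classWeight p a ≤ 3)
    (hk : 2 * order P L ^ 2 + 5 ≤ Fintype.card X + 2 * order P L) (a : P) :
    2 * (order P L : ℤ) * ((classWeight p a : ℤ) ^ 2 - classWeight p a) ≤
      2 * ∑ l ∈ determinedLines p G a, deficiencySq p l + classWeight p a := by
  classical
  have hnn : ∀ l ∈ determinedLines p G a, 0 ≤ deficiencySq p l := fun l _ => sq_nonneg _
  have hnn' := sum_nonneg hnn
  have ha := hw a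
  rcases (show classWeight p a = 0 ∨ classWeight p a = 1 ∨ classWeight p a = 2 ∨
    classWeight p a = 3 by omega) with e | e | e | e
  · simpa [e] using hnn'
  · simp only [e]; norm_num; linarith
  · have hclass := e
    rw [classWeight, card_eq_two] at hclass
    obtain ⟨x, y, hxy, hs⟩ := hclass
    have hmem : ∀ t, t = x ∨ t = y → p t = a := fun t ht => by
      have := Finset.ext_iff.1 hs t
      simp only [mem_insert, mem_singleton, mem_filter, mem_univ, true_and] at this
      exact this.2 ht
    have hx := hmem x (by simp)
    have hy := hmem y (by simp)
    obtain ⟨l, ⟨hl, e₁⟩, -⟩ := h.existsUnique_line x y hxy (hx.trans hy.symm)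
    have hm : l ∈ determinedLines p G a :=
      hx ▸ mem_determinedLines_of_eq hxy (hx.trans hy.symm) hl e₁
    have h1 := single_le_sum hnn hm
    have h2 := h.lineWeight_le_of_mem_determinedLines hm
    have h3 := sq_le_deficiencySq h2 (by omega)
    rw [e] at h3 ⊢
    push_cast at h3 ⊢
    rcases hq with h5 | h7
    · rw [h5] at h3 ⊢
      norm_num at h3 ⊢
      linarith
    · have h7' : (7 : ℤ) ≤ order P L := by exact_mod_cast h7
      nlinarith
  · have := h.classWeight_three_bound hq hw hk e
    rw [e]
    push_cast
    linarith

theorem card_le_of_classWeight_le_three (h : IsHjelmslevTriarc p G)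
    (hq : order P L = 5 ∨ 7 ≤ order P L) (hw : ∀ a, classWeight p a ≤ 3) :
    Fintype.card X + 2 * order P L ≤ 2 * order P L ^ 2 + 4 := by
  by_contra! hk
  have hk' : 2 * order P L ^ 2 + 5 ≤ Fintype.card X + 2 * order P L := by omega
  have hq5 : 5 ≤ order P L := by omega
  obtain ⟨x⟩ : Nonempty X := by
    rw [← Fintype.card_pos_iff]
    nlinarith
  have hub : Fintype.card X ≤ 2 * order P L ^ 2 + 2 * order P L + 1 := by
    have h1 := h.card_add_le x
    have h2 : 1 ≤ classWeight p (p x) := card_pos.2 ⟨x, by simp⟩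
    nlinarith
  have h1 := (sum_le_sum fun a (_ : a ∈ univ) => h.classWeight_bound hq hw hk' a)
  have h2 := h.sum_determinedLines_le
  rw [sum_deficiencySq] at h2
  rw [sum_add_distrib, ← mul_sum, ← mul_sum, sum_sub_distrib] at h1
  have h3 : ∑ a, (classWeight p a : ℤ) = Fintype.card X := by exact_mod_cast sum_classWeight p
  rw [h3] at h1
  zify at hk' hub hq5
  generalize ∑ a, (classWeight p a : ℤ) ^ 2 = S at *
  generalize (order P L : ℤ) = q at *
  generalize (Fintype.card X : ℤ) = k at *
  -- The terms in `S` have cancelled, leaving a quadratic in k that is negative on the remaining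
  -- range.
  have h4 : 0 ≤ 2 * k ^ 2 - 8 * q * (q + 1) * k + 8 * q ^ 2 * (q ^ 2 + q + 1)
      + (2 * q + 1) * k := by linarith
  -- The second factor is chosen so that `h4` plus twice this product has no k² and only k as linear
  -- term. With `hub` this leaves -4q³ + 30q² - 68q + 51 ≥ 0, false for q ≥ 5.
  have h5 : 0 ≤ (k - (2 * q ^ 2 - 2 * q + 5)) * ((2 * q ^ 2 + 5 * q - 5) - k) :=
    mul_nonneg (by linarith) (by linarith)
  nlinarith [mul_nonneg (sub_nonneg.2 hq5) (sub_nonneg.2 hq5),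
    mul_nonneg (mul_nonneg (sub_nonneg.2 hq5) (sub_nonneg.2 hq5)) (sub_nonneg.2 hq5)]

theorem card_le_of_odd (h : IsHjelmslevTriarc p G) (hq : order P L = 5 ∨ 7 ≤ order P L)
    (ho : Odd (order P L)) : Fintype.card X + 2 * order P L ≤ 2 * order P L ^ 2 + 4 := by
  by_cases hw : ∀ a, classWeight p a ≤ 3
  · exact h.card_le_of_classWeight_le_three hq hw
  · push Not at hw
    obtain ⟨a, ha⟩ := hw
    obtain ⟨x, hx⟩ := card_pos.1 (show 0 < classWeight p a by omega)
    obtain rfl : p x = a := by simpa using hx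
    exact h.card_le_of_four_le_of_odd ho ha

theorem card_le (h : IsHjelmslevTriarc p G) (hq : order P L = 5 ∨ 7 ≤ order P L) :
    Fintype.card X + order P L ≤ 2 * order P L ^ 2 + 4 := by
  by_cases hw : ∀ a, classWeight p a ≤ 3
  · have := h.card_le_of_classWeight_le_three hq hw
    omega
  · push Not at hw
    obtain ⟨a, ha⟩ := hw
    obtain ⟨x, hx⟩ := card_pos.1 (show 0 < classWeight p a by omega)
    obtain rfl : p x = a := by simpa using hx
    exact h.card_le_of_four_le ha

end IsHjelmslevTriarc

/-! ### Incidence in PG(2,F) by dot products. -/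

namespace Configuration.ofField

open scoped LinearAlgebra.Projectivization Matrix
open Projectivization ProjectivePlane

variable {F : Type*} [Field F]

theorem mem_iff_rep {a l : ℙ F (Fin 3 → F)} : a ∈ l ↔ a.rep ⬝ᵥ l.rep = 0 := by
  rw [← orthogonal_mk a.rep_nonzero l.rep_nonzero, mk_rep, mk_rep]
  rfl

theorem mk_mem_iff {v : Fin 3 → F} (hv : v ≠ 0) {l : ℙ F (Fin 3 → F)} :
    mk F v hv ∈ l ↔ v ⬝ᵥ l.rep = 0 := by
  rw [← orthogonal_mk hv l.rep_nonzero, mk_rep]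
  rfl

theorem mk_eq_iff_smul_rep {v : Fin 3 → F} (hv : v ≠ 0) {a : ℙ F (Fin 3 → F)} :
    mk F v hv = a ↔ ∃ t : F, v = t • a.rep := by
  conv_lhs => rw [← mk_rep a]
  rw [mk_eq_mk_iff']
  simp [eq_comm]

theorem order_eq [DecidableEq F] [Finite F] :
    order (ℙ F (Fin 3 → F)) (ℙ F (Fin 3 → F)) = Nat.card F := by
  have := Fintype.ofFinite (ℙ F (Fin 3 → F))
  have h1 := card_points (ℙ F (Fin 3 → F)) (ℙ F (Fin 3 → F))
  have h2 := Projectivization.card_of_finrank F (Fin 3 → F) (n := 3) (by simp)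
  rw [Nat.card_eq_fintype_card, h1] at h2
  simp only [sum_range_succ, sum_range_zero, pow_zero, pow_one] at h2
  set o := order (ℙ F (Fin 3 → F)) (ℙ F (Fin 3 → F))
  rcases lt_trichotomy o (Nat.card F) with h | h | h
  · nlinarith
  · exact h
  · nlinarith

/-- Cramer's rule, with a third vector `w` completing the two representatives to a basis. -/
theorem exists_dotProduct_eq_of_ne {a b : ℙ F (Fin 3 → F)} (h : a ≠ b) (s t : F) :
    ∃ c : Fin 3 → F, c ⬝ᵥ a.rep = s ∧ c ⬝ᵥ b.rep = t := by
  have hn : crossProduct a.rep b.rep ≠ 0 := fun e => h <| by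
    rw [← mk_rep a, ← mk_rep b]
    exact (mk_eq_mk_iff_crossProduct_eq_zero a.rep_nonzero b.rep_nonzero).2 e
  obtain ⟨w, hw⟩ : ∃ w, crossProduct a.rep b.rep ⬝ᵥ w ≠ 0 := by
    by_contra! hcon
    exact hn (dotProduct_eq_zero_iff.1 hcon)
  set u := a.rep
  set v := b.rep
  refine ⟨(crossProduct u v ⬝ᵥ w)⁻¹ • (s • crossProduct v w + t • crossProduct w u), ?_, ?_⟩
  · have e : (s • crossProduct v w + t • crossProduct w u) ⬝ᵥ u = s * (crossProduct u v ⬝ᵥ w) := by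
      simp [cross_apply, dotProduct, Fin.sum_univ_three]; ring
    rw [smul_dotProduct, e, smul_eq_mul]
    field_simp
  · have e : (s • crossProduct v w + t • crossProduct w u) ⬝ᵥ v = t * (crossProduct u v ⬝ᵥ w) := by
      simp [cross_apply, dotProduct, Fin.sum_univ_three]; ring
    rw [smul_dotProduct, e, smul_eq_mul]
    field_simp

theorem exists_ne_mem [DecidableEq F] [Finite F] (a l : ℙ F (Fin 3 → F)) :
    ∃ m : ℙ F (Fin 3 → F), a ∈ m ∧ m ≠ l := by
  classical
  have := Fintype.ofFinite (ℙ F (Fin 3 → F))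
  have h := card_lines_through (L := ℙ F (Fin 3 → F)) a
  have h1 := one_lt_order (ℙ F (Fin 3 → F)) (ℙ F (Fin 3 → F))
  obtain ⟨m, hm, hne⟩ := exists_mem_ne (show 1 < #{l : ℙ F (Fin 3 → F) | a ∈ l} by omega) l
  exact ⟨m, by simpa using hm, hne⟩

end Configuration.ofField

open scoped LinearAlgebra.Projectivization Matrix

open scoped Classical in
/-- Coordinates over the residue field for a set of points of a projective Hjelmslev plane: `p x`
is the neighbour class of `x`, `d x` its position inside the class, and for a neighbour class of
lines `l` the lines in the class are parametrised by `c : F³`, with `G l x` the inhomogeneous part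
of the incidence condition. All these lines have multiplicity at most three. -/
structure IsCoordinatizedTriarc {F X : Type*} [Field F] [Fintype X] (p : X → ℙ F (Fin 3 → F))
    (d : X → Fin 3 → F) (G : ℙ F (Fin 3 → F) → X → F) : Prop where
  card_le_three : ∀ (l : ℙ F (Fin 3 → F)) (c : Fin 3 → F),
    #{x | p x ∈ l ∧ G l x + c ⬝ᵥ (p x).rep = 0} ≤ 3
  eq_iff : ∀ l x y, p x = p y → p x ∈ l → (G l x = G l y ↔ (d x - d y) ⬝ᵥ l.rep = 0)
  eq_of_smul : ∀ x y (t : F), p x = p y → d x - d y = t • (p x).rep → x = y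

/-! ### From coordinates to the combinatorial axioms. -/

namespace IsCoordinatizedTriarc

open Projectivization ofField ProjectivePlane

variable {F X : Type*} [Field F] [Fintype X] {p : X → ℙ F (Fin 3 → F)}
    {d : X → Fin 3 → F} {G : ℙ F (Fin 3 → F) → X → F}

/-- Parallel segments in distinct classes lie on a common line: `c` may be prescribed at both
classes. -/
theorem segmentWeight_add_le (h : IsCoordinatizedTriarc p d G) (l x y) (hx : p x ∈ l)
    (hy : p y ∈ l) (hxy : p x ≠ p y) : segmentWeight p G l x + segmentWeight p G l y ≤ 3 := by
  classical
  obtain ⟨c, hcx, hcy⟩ := exists_dotProduct_eq_of_ne hxy (-G l x) (-G l y)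
  rw [segmentWeight, segmentWeight, ← card_union_of_disjoint]
  · refine (card_le_card fun z hz => ?_).trans (h.card_le_three l c)
    rcases mem_union.1 hz with hz | hz <;> obtain ⟨h1, h2⟩ := (mem_filter.1 hz).2 <;>
      rw [mem_filter, h1, h2]
    · exact ⟨mem_univ _, hx, by rw [hcx, add_neg_cancel]⟩
    · exact ⟨mem_univ _, hy, by rw [hcy, add_neg_cancel]⟩
  · rw [disjoint_left]
    intro z hz hz'
    exact hxy ((mem_filter.1 hz).2.1.symm.trans (mem_filter.1 hz').2.1)

theorem mul_segmentWeight_add_le [Finite F] (h : IsCoordinatizedTriarc p d G) (l x)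
    (hx : p x ∈ l) : Nat.card F * segmentWeight p G l x + lineWeight p l ≤
      3 * Nat.card F + classWeight p (p x) := by
  classical
  have := Fintype.ofFinite F
  -- The q lines through the segment are `c + t • m.rep`: `m.rep` vanishes at `p x` but at no other
  -- point of `l`, so a point elsewhere over `l` is hit for exactly one `t`.
  obtain ⟨m, hm, hml⟩ := exists_ne_mem (p x) l
  obtain ⟨b, hb⟩ : ∃ b : ℙ F (Fin 3 → F), b ≠ p x := by
    obtain ⟨b, hb⟩ := Nondegenerate.exists_point (P := ℙ F (Fin 3 → F)) l
    exact ⟨b, fun e => hb (e ▸ hx)⟩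
  obtain ⟨c, hc, -⟩ := exists_dotProduct_eq_of_ne hb.symm (-G l x) 0
  have hsplit : lineWeight p l = #{y | p y ∈ l ∧ p y ≠ p x} + classWeight p (p x) := by
    rw [lineWeight, ← card_filter_add_card_filter_not (fun y => p y ≠ p x), filter_filter,
      filter_filter, classWeight]
    congr 2
    ext y
    simp only [not_not, mem_filter, mem_univ, true_and, and_iff_right_iff_imp]
    exact fun e => e ▸ hx
  have hsum : ∑ t : F, #{y | p y ∈ l ∧ G l y + (c + t • m.rep) ⬝ᵥ (p y).rep = 0} ≤
      3 * Nat.card F := by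
    refine (sum_le_card_nsmul _ _ 3 fun t _ => h.card_le_three l _).trans ?_
    rw [card_univ, Nat.card_eq_fintype_card, smul_eq_mul, mul_comm]
  have hlow : Nat.card F * segmentWeight p G l x + #{y | p y ∈ l ∧ p y ≠ p x} ≤
      ∑ t : F, #{y | p y ∈ l ∧ G l y + (c + t • m.rep) ⬝ᵥ (p y).rep = 0} := by
    simp_rw [card_filter (fun y => p y ∈ l ∧ G l y + _ = 0)]
    rw [sum_comm, segmentWeight, card_filter, card_filter, mul_sum, ← sum_add_distrib]
    refine sum_le_sum fun y _ => ?_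
    rw [← card_filter]
    by_cases hyx : p y = p x
    · rw [if_neg (show ¬ (p y ∈ l ∧ p y ≠ p x) by simp [hyx]), add_zero]
      split_ifs with hG
      · rw [mul_one, Nat.card_eq_fintype_card, ← card_univ]
        refine card_le_card fun t _ => mem_filter.2 ⟨mem_univ _, hyx ▸ hx, ?_⟩
        rw [hyx, hG.2, add_dotProduct, hc, smul_dotProduct, dotProduct_comm, mem_iff_rep.1 hm]
        simp
      · simp
    · rw [if_neg (show ¬ (p y = p x ∧ G l y = G l x) by simp [hyx]), mul_zero, zero_add]
      split_ifs with hy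
      · have hne : m.rep ⬝ᵥ (p y).rep ≠ 0 := fun e => by
          rw [dotProduct_comm, ← mem_iff_rep] at e
          rcases Nondegenerate.eq_or_eq hx hy.1 hm e with e | e
          · exact hyx e.symm
          · exact hml e.symm
        refine card_pos.2 ⟨-(G l y + c ⬝ᵥ (p y).rep) / (m.rep ⬝ᵥ (p y).rep), mem_filter.2
          ⟨mem_univ _, hy.1, ?_⟩⟩
        rw [add_dotProduct, smul_dotProduct, smul_eq_mul, div_mul_cancel₀ _ hne]
        ring
      · exact Nat.zero_le _
  omega

/-- The difference `d x - d y` is not a multiple of `(p x).rep`, so it gives a second point of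
PG(2,F); the direction is the join of the two. -/
theorem existsUnique_line (h : IsCoordinatizedTriarc p d G) (x y) (hxy : x ≠ y)
    (hp : p x = p y) : ∃! l, p x ∈ l ∧ G l x = G l y := by
  classical
  have h0 : d x - d y ≠ 0 := fun e => hxy (h.eq_of_smul x y 0 hp (by rw [e, zero_smul]))
  have hne : p x ≠ Projectivization.mk F _ h0 := fun e => by
    obtain ⟨t, ht⟩ := (mk_eq_iff_smul_rep h0).1 e.symm
    exact hxy (h.eq_of_smul x y t hp ht)
  obtain ⟨l, hl, hu⟩ := HasLines.existsUnique_line _ (ℙ F (Fin 3 → F)) _ _ hne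
  refine ⟨l, ⟨hl.1, (h.eq_iff l x y hp hl.1).2 ((mk_mem_iff h0).1 hl.2)⟩, fun m hm => ?_⟩
  exact hu m ⟨hm.1, (mk_mem_iff h0).2 ((h.eq_iff m x y hp hm.1).1 hm.2)⟩

theorem eq_of_parallelogram (h : IsCoordinatizedTriarc p d G) (h2 : (2 : F) ≠ 0)
    (x₁ x₂ x₃ x₄ l₂ l₃ l₄)
    (h₂ : p x₁ = p x₂) (h₃ : p x₁ = p x₃) (h₄ : p x₁ = p x₄) (hl₂ : p x₁ ∈ l₂) (hl₃ : p x₁ ∈ l₃)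
    (hl₄ : p x₁ ∈ l₄) (hne : l₂ ≠ l₃) (e₁ : G l₂ x₁ = G l₂ x₂) (e₂ : G l₂ x₃ = G l₂ x₄)
    (e₃ : G l₃ x₁ = G l₃ x₃) (e₄ : G l₃ x₂ = G l₃ x₄) (e₅ : G l₄ x₁ = G l₄ x₄)
    (e₆ : G l₄ x₂ = G l₄ x₃) : G l₄ x₁ = G l₄ x₂ := by
  rw [h.eq_iff _ _ _ h₂ hl₂] at e₁
  rw [h.eq_iff _ _ _ (h₃.symm.trans h₄) (h₃ ▸ hl₂)] at e₂
  rw [h.eq_iff _ _ _ h₃ hl₃] at e₃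
  rw [h.eq_iff _ _ _ (h₂.symm.trans h₄) (h₂ ▸ hl₃)] at e₄
  rw [h.eq_iff _ _ _ h₄ hl₄] at e₅
  rw [h.eq_iff _ _ _ (h₂.symm.trans h₃) (h₂ ▸ hl₄)] at e₆
  rw [h.eq_iff _ _ _ h₂ hl₄]
  -- This vector is orthogonal to `l₂` and `l₃`, so it is zero or represents their intersection `p
  -- x₁`, which lies on `l₄`.
  have key : (d x₁ - d x₂ - d x₃ + d x₄) ⬝ᵥ l₄.rep = 0 := by
    by_cases h0 : d x₁ - d x₂ - d x₃ + d x₄ = 0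
    · rw [h0, zero_dotProduct]
    · have m₂ : Projectivization.mk F _ h0 ∈ l₂ := (mk_mem_iff h0).2 <| by
        simp only [sub_dotProduct, add_dotProduct] at *
        linear_combination e₁ - e₂
      have m₃ : Projectivization.mk F _ h0 ∈ l₃ := (mk_mem_iff h0).2 <| by
        simp only [sub_dotProduct, add_dotProduct] at *
        linear_combination e₃ - e₄
      rcases Nondegenerate.eq_or_eq hl₂ m₂ hl₃ m₃ with e | e
      · rw [← mk_mem_iff h0, ← e]
        exact hl₄
      · exact (hne e).elim
  refine (mul_eq_zero.1 (?_ : (2 : F) * _ = 0)).resolve_left h2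
  simp only [sub_dotProduct, add_dotProduct] at *
  linear_combination key + e₅ - e₆

/-- With at most one arc point per segment, the points over `l` embed in PG(2,5). Lines of that
plane are lines of the class `l` or, through one special point, neighbour classes of points; both
meet the image in at most 3 points. -/
theorem lineWeight_le_eleven [DecidableEq F] [Finite F]
    (h : IsCoordinatizedTriarc p d G)
    (l : ℙ F (Fin 3 → F)) (hinj : ∀ x y, p x ∈ l → p x = p y → G l x = G l y → x = y)
    (hw : ∀ a, classWeight p a ≤ 3) (h5 : Nat.card F = 5) : lineWeight p l ≤ 11 := by
  classical
  have := Fintype.ofFinite (ℙ F (Fin 3 → F))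
  obtain ⟨k, hk⟩ : ∃ k, l.rep k ≠ 0 := Function.ne_iff.1 l.rep_nonzero
  have hext : ∀ u v : Fin 3 → F, u ⬝ᵥ l.rep = 0 → v ⬝ᵥ l.rep = 0 → (∀ i ≠ k, u i = v i) → u = v := by
    intro u v hu hv huv
    have hz : (u - v) ⬝ᵥ l.rep = 0 := by rw [sub_dotProduct, hu, hv, sub_zero]
    rw [dotProduct, sum_eq_single k (fun i _ hi => by simp [huv i hi]) (by simp)] at hz
    funext i
    by_cases hi : i = k
    · subst hi
      exact sub_eq_zero.1 ((mul_eq_zero.1 hz).resolve_right hk)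
    · exact huv i hi
  -- Since `l.rep k ≠ 0`, coordinate `k` of a point on `l` is redundant; storing `G l x` there makes
  -- the incidence condition linear in `φ x`.
  set φ : X → Fin 3 → F := fun x => Function.update (p x).rep k (G l x) with hφ
  have hφi : ∀ x, ∀ i ≠ k, φ x i = (p x).rep i := fun x i hi => by simp [hφ, hi]
  have hφk : ∀ x, φ x k = G l x := fun x => by simp [hφ]
  have hφdot : ∀ (x) (c : Fin 3 → F), φ x ⬝ᵥ c =
      (p x).rep ⬝ᵥ Function.update c k 0 + G l x * c k := fun x c => by
    rw [dotProduct, dotProduct, ← add_sum_erase _ _ (mem_univ k), ← add_sum_erase _ _ (mem_univ k)]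
    rw [hφk, Function.update_self, mul_zero, zero_add, add_comm]
    congr 1
    refine sum_congr rfl fun i hi => ?_
    rw [hφi x i (ne_of_mem_erase hi), Function.update_of_ne (ne_of_mem_erase hi)]
  have hne : ∀ x, p x ∈ l → φ x ≠ 0 := fun x hx e => (p x).rep_nonzero <|
    hext _ _ (mem_iff_rep.1 hx) (zero_dotProduct _) fun i hi => by
      rw [← hφi x i hi, e]
  set Y : Finset X := {x | p x ∈ l} with hY
  have hYl : ∀ x : Y, p x ∈ l := fun x => (mem_filter.1 x.2).2
  set ψ : Y → ℙ F (Fin 3 → F) := fun x => Projectivization.mk F (φ x) (hne x (hYl x)) with hψ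
  have hψinj : Function.Injective ψ := by
    intro x y hxy
    obtain ⟨t, ht⟩ := (mk_eq_mk_iff' ..).1 hxy
    have hrep : (p x).rep = t • (p y).rep := by
      refine hext _ _ (mem_iff_rep.1 (hYl x)) ?_ fun i hi => ?_
      · rw [smul_dotProduct, mem_iff_rep.1 (hYl y), smul_zero]
      · rw [← hφi x i hi, ← ht, Pi.smul_apply, hφi y i hi, Pi.smul_apply]
    have hp : p x = p y := by
      rw [← mk_rep (p x), mk_eq_iff_smul_rep]
      exact ⟨t, hrep⟩
    have ht1 : t = 1 := by
      rw [hp] at hrep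
      have : (t - 1) • (p y).rep = 0 := by rw [sub_smul, ← hrep, one_smul, sub_self]
      exact sub_eq_zero.1 ((smul_eq_zero.1 this).resolve_right (p y).rep_nonzero)
    refine Subtype.ext (hinj x y (hYl x) hp ?_)
    rw [← hφk, ← ht, ht1, one_smul, hφk]
  have hcard : #(univ.image ψ) = lineWeight p l := by
    rw [card_image_of_injective _ hψinj, card_univ, Fintype.card_coe, lineWeight]
  rw [← hcard]
  refine card_le_eleven_of_order_eq_five (L := ℙ F (Fin 3 → F)) (order_eq.trans h5) _ fun m => ?_
  rw [filter_image]
  refine card_image_le.trans ?_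
  rw [← card_map (Function.Embedding.subtype _)]
  have hmem : ∀ x ∈ ({y : Y | ψ y ∈ m} : Finset Y).map (Function.Embedding.subtype _),
      p x ∈ l ∧ (p x).rep ⬝ᵥ Function.update m.rep k 0 + G l x * m.rep k = 0 := by
    intro x hx
    obtain ⟨y, hy, rfl⟩ := mem_map.1 hx
    refine ⟨hYl y, ?_⟩
    have := (mem_filter.1 hy).2
    rw [hψ, mk_mem_iff] at this
    rw [← hφdot]
    exact this
  by_cases hmk : m.rep k = 0
  · have hml : l ≠ m := fun e => hk (e ▸ hmk)
    obtain ⟨a, -, ha⟩ := HasPoints.existsUnique_point (ℙ F (Fin 3 → F)) _ l m hml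
    refine (card_le_card fun x hx => ?_).trans (hw a)
    obtain ⟨h1, h2⟩ := hmem x hx
    refine mem_filter.2 ⟨mem_univ _, ha _ ⟨h1, mem_iff_rep.2 ?_⟩⟩
    rw [hmk, mul_zero, add_zero] at h2
    rw [← h2, ← hmk, Function.update_eq_self]
  · refine (card_le_card fun x hx => ?_).trans
      (h.card_le_three l ((m.rep k)⁻¹ • Function.update m.rep k 0))
    obtain ⟨h1, h2⟩ := hmem x hx
    simp only [mem_filter, mem_univ, true_and]
    refine ⟨h1, ?_⟩
    rw [smul_dotProduct, smul_eq_mul, dotProduct_comm]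
    field_simp
    linear_combination h2

theorem isHjelmslevTriarc [DecidableEq F] [Finite F] (h : IsCoordinatizedTriarc p d G) :
    IsHjelmslevTriarc p G where
  segmentWeight_add_le := h.segmentWeight_add_le
  mul_segmentWeight_add_le := by rw [order_eq]; exact h.mul_segmentWeight_add_le
  existsUnique_line := h.existsUnique_line
  eq_of_parallelogram ho := by
    refine h.eq_of_parallelogram fun h2 => ?_
    have := Fintype.ofFinite F
    rw [order_eq, Nat.card_eq_fintype_card] at ho
    have hch : ringChar F = 2 := by
      have h3 : ringChar F ∣ 2 := (ringChar.spec F 2).1 (by exact_mod_cast h2)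
      exact ((Nat.dvd_prime Nat.prime_two).1 h3).resolve_left (CharP.ringChar_ne_one)
    have := FiniteField.even_card_iff_char_two.1 hch
    rw [Nat.odd_iff] at ho
    omega
  lineWeight_le_eleven h5 l hinj hw :=
    h.lineWeight_le_eleven l hinj hw (order_eq.symm.trans h5)

end IsCoordinatizedTriarc

/-- Coordinates on the radical `ker π` of a chain ring of length two with residue map `π`: the
additive map `h` identifies the residue field with the radical, `R` acts on the left through `π`
and on the right through the residue field endomorphism `σ`. -/
structure IsRadicalCoordinate {R F : Type*} [Ring R] [Field F] (π : R →+* F) (h : F →+ R)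
    (σ : F →+* F) : Prop where
  surjective : Function.Surjective π
  injective : Function.Injective h
  map_eq_zero_iff : ∀ a, π a = 0 ↔ ∃ t, h t = a
  mul_left : ∀ r t, r * h t = h (π r * t)
  mul_right : ∀ t r, h t * r = h (t * σ (π r))

/-! ### Structure of chain rings of length two. -/

section

variable {R F : Type*} [Ring R] [Field F]

/-- If `s` lifts the inverse of `π r`, then `r * s - 1` squares to zero, so `r * s` has inverse `2 -
r * s`; likewise on the other side. -/
theorem isUnit_of_map_ne_zero {π : R →+* F} (hsurj : Function.Surjective π)
    (hsq : ∀ a b, π a = 0 → π b = 0 → a * b = 0) {r : R} (hr : π r ≠ 0) : IsUnit r := by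
  obtain ⟨s, hs⟩ := hsurj (π r)⁻¹
  have h1 : (r * s - 1) * (r * s - 1) = 0 := by apply hsq <;> simp [hs, hr]
  have h2 : (s * r - 1) * (s * r - 1) = 0 := by apply hsq <;> simp [hs, hr]
  have e1 : r * (s * (2 - r * s)) = 1 := by
    have : r * (s * (2 - r * s)) = 1 - (r * s - 1) * (r * s - 1) := by noncomm_ring
    rw [this, h1, sub_zero]
  have e2 : ((2 - s * r) * s) * r = 1 := by
    have : ((2 - s * r) * s) * r = 1 - (s * r - 1) * (s * r - 1) := by noncomm_ring
    rw [this, h2, sub_zero]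
  have e3 := left_inv_eq_right_inv e2 e1
  exact ⟨⟨r, _, e1, e3 ▸ e2⟩, rfl⟩

/-- The radical is `R θ` for any nonzero `θ` in it, by the chain condition, and `r * θ` depends only
on `π r`. So `h (π r) = r * θ`, and `σ` records the commutation rule `θ * r = h (σ (π r))`. -/
theorem exists_isRadicalCoordinate (hR : IsChainRingOfLengthTwo R)
    (hres : Nonempty ((R ⧸ Ring.jacobson R) ≃+* F)) :
    ∃ (π : R →+* F) (h : F →+ R) (σ : F →+* F), IsRadicalCoordinate π h σ := by
  obtain ⟨e⟩ := hres
  set π : R →+* F := e.toRingHom.comp (Ideal.Quotient.mk (Ring.jacobson R)) with hπ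
  have hker : ∀ a, π a = 0 ↔ a ∈ Ring.jacobson R := fun a => by
    rw [← Ideal.Quotient.eq_zero_iff_mem]
    simp [hπ]
  have hsurj : Function.Surjective π := e.surjective.comp Ideal.Quotient.mk_surjective
  have hsq : ∀ a b, π a = 0 → π b = 0 → a * b = 0 := fun a b ha hb =>
    hR.radical_mul_eq_zero a ((hker a).1 ha) b ((hker b).1 hb)
  have hunit : ∀ {r}, π r ≠ 0 → IsUnit r := fun hr => isUnit_of_map_ne_zero hsurj hsq hr
  obtain ⟨θ, hθJ, hθ0⟩ := Submodule.exists_mem_ne_zero_of_ne_bot hR.radical_ne_bot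
  have hθ : π θ = 0 := (hker θ).2 hθJ
  have hgen : ∀ a, π a = 0 → ∃ r, a = r * θ := fun a ha => by
    rcases hR.left_chain (Submodule.span R {a}) (Submodule.span R {θ}) with hle | hle
    · obtain ⟨r, hr⟩ := Submodule.mem_span_singleton.1 (hle (Submodule.mem_span_singleton_self a))
      exact ⟨r, hr.symm⟩
    · obtain ⟨r, hr⟩ := Submodule.mem_span_singleton.1 (hle (Submodule.mem_span_singleton_self θ))
      rw [smul_eq_mul] at hr
      have hr0 : π r ≠ 0 := fun h0 => hθ0 (by rw [← hr, hsq r a h0 ha])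
      obtain ⟨u, rfl⟩ := hunit hr0
      exact ⟨↑u⁻¹, by rw [← hr, Units.inv_mul_cancel_left]⟩
  have hcongr : ∀ {r s}, π r = π s → r * θ = s * θ := fun {r s} hrs => by
    rw [← sub_eq_zero, ← sub_mul]
    exact hsq _ _ (by rw [map_sub, hrs, sub_self]) hθ
  have hcongr' : ∀ {r s}, π r = π s → θ * r = θ * s := fun {r s} hrs => by
    rw [← sub_eq_zero, ← mul_sub]
    exact hsq _ _ hθ (by rw [map_sub, hrs, sub_self])
  have hι : ∀ t, π (Function.surjInv hsurj t) = t := Function.surjInv_eq hsurj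
  let h : F →+ R := AddMonoidHom.mk' (fun t => Function.surjInv hsurj t * θ) fun s t => by
    rw [← add_mul]
    exact hcongr (by rw [map_add, hι, hι, hι])
  have hh : ∀ r, h (π r) = r * θ := fun r => hcongr (hι _)
  have hinj : Function.Injective h := by
    rw [injective_iff_map_eq_zero]
    intro t ht
    obtain ⟨r, rfl⟩ := hsurj t
    by_contra h0
    rw [hh] at ht
    exact hθ0 ((hunit h0).mul_right_eq_zero.1 ht)
  have hrange : ∀ a, π a = 0 ↔ ∃ t, h t = a := fun a => by
    constructor
    · intro ha
      obtain ⟨r, rfl⟩ := hgen a ha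
      exact ⟨π r, hh r⟩
    · rintro ⟨t, rfl⟩
      obtain ⟨r, rfl⟩ := hsurj t
      rw [hh, map_mul, hθ, mul_zero]
  have hleft : ∀ r t, r * h t = h (π r * t) := fun r t => by
    obtain ⟨s, rfl⟩ := hsurj t
    rw [← map_mul, hh, hh, mul_assoc]
  have hex : ∀ t, ∃ s, h s = θ * Function.surjInv hsurj t := fun t =>
    (hrange _).1 (by rw [map_mul, hθ, zero_mul])
  choose σ' hσ' using hex
  have hσ : ∀ r, h (σ' (π r)) = θ * r := fun r => (hσ' _).trans (hcongr' (hι _))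
  have hright : ∀ t r, h t * r = h (t * σ' (π r)) := fun t r => by
    obtain ⟨s, rfl⟩ := hsurj t
    rw [hh, mul_assoc, ← hσ, hleft]
  let σ : F →+* F :=
    { toFun := σ'
      map_one' := hinj <| by
        rw [← map_one π, hσ, hh, mul_one, one_mul]
      map_zero' := hinj <| by
        rw [← map_zero π, hσ, hh, mul_zero, zero_mul]
      map_add' := fun s t => hinj <| by
        obtain ⟨a, rfl⟩ := hsurj s
        obtain ⟨b, rfl⟩ := hsurj t
        rw [map_add h, ← map_add π, hσ, hσ, hσ, mul_add]
      map_mul' := fun s t => hinj <| by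
        obtain ⟨a, rfl⟩ := hsurj s
        obtain ⟨b, rfl⟩ := hsurj t
        rw [← map_mul π, hσ, ← hright, hσ, mul_assoc] }
  exact ⟨π, h, σ, hsurj, hinj, hrange, hleft, hright⟩

/-! ### Coordinates for points and lines of the Hjelmslev plane. -/

namespace PHG

open MulOpposite

/-- The right submodule of `R³` cut out by a linear form with coefficients on the left. -/
def formKer (a : Fin 3 → R) : Submodule Rᵐᵒᵖ (Fin 3 → R) where
  carrier := {v | ∑ i, a i * v i = 0}
  add_mem' {v w} hv hw := by
    simp only [Set.mem_ofPred_eq, Pi.add_apply, mul_add, sum_add_distrib] at *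
    rw [hv, hw, add_zero]
  zero_mem' := by simp
  smul_mem' r v hv := by
    simp only [Set.mem_ofPred_eq, Pi.smul_apply] at *
    induction r with | _ r =>
    simp only [op_smul_eq_mul, ← mul_assoc, ← sum_mul, hv, zero_mul]

theorem mem_formKer {a v : Fin 3 → R} : v ∈ formKer a ↔ ∑ i, a i * v i = 0 := Iff.rfl

theorem isFreeOfRank_formKer {a : Fin 3 → R} {k : Fin 3} (hk : IsUnit (a k)) :
    IsFreeOfRank 2 (formKer a) := by
  obtain ⟨u, hu⟩ := hk
  let e : formKer a ≃ₗ[Rᵐᵒᵖ] (Fin 2 → Rᵐᵒᵖ) :=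
    { toFun := fun v i => op (v.1 (k.succAbove i))
      map_add' := fun v w => rfl
      map_smul' := fun r v => by
        funext i
        induction r with | _ r => simp
      invFun := fun w => ⟨k.insertNth (-(↑u⁻¹ * ∑ i, a (k.succAbove i) * unop (w i)))
        fun i => unop (w i), by
          rw [mem_formKer, Fin.sum_univ_succAbove _ k]
          simp [← hu]⟩
      left_inv := fun v => by
        have hv := mem_formKer.1 v.2
        rw [Fin.sum_univ_succAbove _ k, ← hu] at hv
        apply Subtype.ext
        funext i
        refine Fin.succAboveCases k ?_ (fun j => ?_) i
        · simp only [Fin.insertNth_apply_same, unop_op]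
          rw [← eq_neg_iff_add_eq_zero] at hv
          rw [← mul_neg, ← hv, Units.inv_mul_cancel_left]
        · simp
      right_inv := fun w => by
        funext i
        simp }
  exact ⟨Module.Basis.ofEquivFun e⟩

theorem exists_generator {N : Submodule Rᵐᵒᵖ (Fin 3 → R)} (hN : IsFreeOfRank 1 N) :
    ∃ v ∈ N, (∀ w ∈ N, ∃ r : R, w = op r • v) ∧ ∀ r : R, op r • v = 0 → r = 0 := by
  obtain ⟨b⟩ := hN
  refine ⟨b 0, (b 0).2, fun w hw => ?_, fun r hr => ?_⟩
  · refine ⟨unop (b.repr ⟨w, hw⟩ 0), ?_⟩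
    have := b.sum_repr ⟨w, hw⟩
    rw [Fin.sum_univ_one] at this
    simpa using (congrArg Subtype.val this).symm
  · have h1 : op r • b 0 = 0 := Subtype.ext hr
    have h2 := congrArg (fun y => b.repr y 0) h1
    simpa using h2

theorem exists_point_coordinates {π : R →+* F} {h : F →+ R} {σ : F →+* F}
    (hc : IsRadicalCoordinate π h σ) (x : Point R) :
    ∃ (a : ℙ F (Fin 3 → F)) (v : Fin 3 → R), v ∈ x.1 ∧ (∀ i, π (v i) = a.rep i) ∧
      ∀ w ∈ x.1, ∃ r : R, w = op r • v := by
  obtain ⟨v, hv, hgen, hfree⟩ := exists_generator x.2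
  have hsq : ∀ a b, π a = 0 → π b = 0 → a * b = 0 := fun a b ha hb => by
    obtain ⟨t, rfl⟩ := (hc.map_eq_zero_iff b).1 hb
    rw [hc.mul_left, ha, zero_mul, map_zero]
  have h0 : (fun i => π (v i)) ≠ 0 := fun e => by
    have h1 : h 1 = 0 := hfree _ <| by
      funext i
      rw [Pi.smul_apply, op_smul_eq_mul, hc.mul_left, show π (v i) = 0 from congrFun e i]
      simp
    exact one_ne_zero (hc.injective (h1.trans (map_zero h).symm))
  obtain ⟨c, hcv⟩ := Projectivization.exists_smul_eq_mk_rep F _ h0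
  obtain ⟨r, hr⟩ := hc.surjective c
  obtain ⟨u, hu⟩ := isUnit_of_map_ne_zero hc.surjective hsq (hr ▸ c.ne_zero)
  refine ⟨Projectivization.mk F _ h0, op r • v, x.1.smul_mem _ hv, fun i => ?_, fun w hw => ?_⟩
  · rw [← hcv, Pi.smul_apply, op_smul_eq_mul, map_mul, hr, mul_comm]
    rfl
  · obtain ⟨s, rfl⟩ := hgen w hw
    refine ⟨↑u⁻¹ * s, ?_⟩
    rw [smul_smul, ← op_mul, ← hu, Units.mul_inv_cancel_left]

theorem multiplicity_eq_card [Fintype (Point R)] {K : Point R → ℕ} (hK : IsProjective K)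
    [Fintype {x // K x = 1}] (S : Set (Point R)) [DecidablePred (· ∈ S)] :
    multiplicity K S = #{x : {x // K x = 1} | x.1 ∈ S} := by
  classical
  rw [multiplicity, finsum_mem_def, finsum_eq_sum_of_fintype,
    ← card_map (Function.Embedding.subtype _), card_eq_sum_ones, ← sum_subset (subset_univ _)]
  · refine sum_congr rfl fun x hx => ?_
    obtain ⟨y, hy, rfl⟩ := mem_map.1 hx
    have := (mem_filter.1 hy).2
    simpa [this] using y.2
  · intro x _ hx
    rw [Set.indicator_apply]
    split_ifs with hS
    · refine (hK x).resolve_right fun h1 => hx ?_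
      exact mem_map.2 ⟨⟨x, h1⟩, by simpa using hS, rfl⟩
    · rfl

theorem exists_isCoordinatizedTriarc [Finite F] {π : R →+* F} {h : F →+ R} {σ : F →+* F}
    (hc : IsRadicalCoordinate π h σ) [Fintype (Point R)] {K : Point R → ℕ} {k : ℕ}
    (hK : IsProjective K) (hA : IsArc K k 3) [Fintype {x // K x = 1}] :
    ∃ (p : {x // K x = 1} → ℙ F (Fin 3 → F)) (d : {x // K x = 1} → Fin 3 → F)
      (G : ℙ F (Fin 3 → F) → {x // K x = 1} → F), IsCoordinatizedTriarc p d G := by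
  classical
  have hsq : ∀ a b, π a = 0 → π b = 0 → a * b = 0 := fun a b ha hb => by
    obtain ⟨t, rfl⟩ := (hc.map_eq_zero_iff b).1 hb
    rw [hc.mul_left, ha, zero_mul, map_zero]
  have hπh : ∀ t, π (h t) = 0 := fun t => (hc.map_eq_zero_iff _).2 ⟨t, rfl⟩
  set ι := Function.surjInv hc.surjective
  have hι : ∀ t, π (ι t) = t := Function.surjInv_eq hc.surjective
  choose p v hvx hvp hgen using fun x : {x // K x = 1} => exists_point_coordinates hc x.1
  have hd : ∀ x i, ∃ t, h t = v x i - ι ((p x).rep i) := fun x i =>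
    (hc.map_eq_zero_iff _).1 (by rw [map_sub, hι, hvp, sub_self])
  choose d hd using hd
  have hv : ∀ x i, v x i = ι ((p x).rep i) + h (d x i) := fun x i => by rw [hd]; abel
  have hg : ∀ l a : ℙ F (Fin 3 → F), ∃ t, a ∈ l → h t = ∑ i, ι (l.rep i) * ι (a.rep i) :=
    fun l a => by
      by_cases hal : a ∈ l
      · obtain ⟨t, ht⟩ := (hc.map_eq_zero_iff (∑ i, ι (l.rep i) * ι (a.rep i))).1 <| by
          rw [map_sum, ← ofField.mem_iff_rep.1 hal, dotProduct]
          exact sum_congr rfl fun i _ => by rw [map_mul, hι, hι, mul_comm]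
        exact ⟨t, fun _ => ht⟩
      · exact ⟨0, fun hh => (hal hh).elim⟩
  choose g hg using hg
  -- Right multiplication twists the radical by `σ`; applying its inverse in `G`, and `σ` to `c` in
  -- the linear form, makes the incidence condition untwisted over `F`.
  obtain ⟨τ, hτ⟩ : ∃ τ : F → F, Function.RightInverse τ σ :=
    (Finite.injective_iff_surjective.1 σ.injective).hasRightInverse
  refine ⟨p, d, fun l x => τ (g l (p x) + d x ⬝ᵥ l.rep), ?_, ?_, ?_⟩
  · intro l c
    set a : Fin 3 → R := fun i => ι (l.rep i) + h (σ (c i)) with ha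
    obtain ⟨i₀, hi₀⟩ : ∃ i, l.rep i ≠ 0 := Function.ne_iff.1 l.rep_nonzero
    have hunit : IsUnit (a i₀) := isUnit_of_map_ne_zero hc.surjective hsq <| by
      rwa [ha, map_add, hι, hπh, add_zero]
    refine le_trans ?_ (hA.2 ⟨formKer a, isFreeOfRank_formKer hunit⟩)
    rw [multiplicity_eq_card hK]
    refine card_le_card fun x hx => ?_
    obtain ⟨hxl, hx0⟩ := (mem_filter.1 hx).2
    have hker : v x ∈ formKer a := by
      rw [mem_formKer]
      have e : ∀ i, a i * v x i = ι (l.rep i) * ι ((p x).rep i) +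
          h (d x i * l.rep i + σ (c i) * σ ((p x).rep i)) := fun i => by
        rw [ha, hv, add_mul, mul_add, mul_add, hc.mul_left, hc.mul_left, hπh, zero_mul, map_zero,
          add_zero, hc.mul_right, hι, hι, map_add, mul_comm (d x i), add_assoc]
      rw [sum_congr rfl fun i _ => e i, sum_add_distrib, ← hg l (p x) hxl, ← map_sum, ← map_add,
        sum_add_distrib, ← add_assoc]
      have h2 := congrArg σ hx0
      rw [map_add, hτ, map_zero, dotProduct, dotProduct, map_sum] at h2
      simp only [map_mul] at h2
      rw [h2, map_zero]
    refine mem_filter.2 ⟨mem_univ _, fun w hw => ?_⟩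
    obtain ⟨r, rfl⟩ := hgen x w hw
    exact (formKer a).smul_mem _ hker
  · intro l x y hxy _
    rw [hτ.injective.eq_iff, hxy, add_right_inj, sub_dotProduct, sub_eq_zero]
  · intro x y t hxy hdt
    -- Moving `d` along the representative rescales the generator by a unit 1 + radical, so the
    -- submodule is unchanged.
    have hxy' : v x = op (1 + h t) • v y := by
      funext i
      rw [Pi.smul_apply, op_smul_eq_mul, mul_add, mul_one, hc.mul_left, hvp, hv, hv, hxy, add_assoc,
        ← map_add]
      congr 2
      have := congrFun hdt i
      rw [Pi.sub_apply, Pi.smul_apply, smul_eq_mul, hxy] at this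
      linear_combination this
    have hyx' : v y = op (1 - h t) • v x := by
      rw [hxy', smul_smul, ← op_mul]
      have : (1 + h t) * (1 - h t) = 1 := by
        rw [mul_sub, mul_one, add_mul, one_mul, hsq _ _ (hπh t) (hπh t)]
        abel
      rw [this, op_one, one_smul]
    refine Subtype.ext (Subtype.ext (le_antisymm (fun w hw => ?_) fun w hw => ?_))
    · obtain ⟨r, rfl⟩ := hgen x w hw
      rw [hxy']
      exact Submodule.smul_mem _ _ (Submodule.smul_mem _ _ (hvx y))
    · obtain ⟨r, rfl⟩ := hgen y w hw
      rw [hyx']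
      exact Submodule.smul_mem _ _ (Submodule.smul_mem _ _ (hvx x))

end PHG

end

theorem mainTheorem8 (q : ℕ) (hq : IsPrimePow q) (hq5 : 5 ≤ q)
    {F : Type*} [Field F] (hF : Nat.card F = q)
    {R : Type*} [Ring R] [Finite R] (hR : IsChainRingOfLengthTwo R)
    (hres : Nonempty ((R ⧸ Ring.jacobson R) ≃+* F)) :
    (Odd q → (PHG.maxArcSize R 3 : ℤ) ≤ 2 * (q : ℤ) ^ 2 - 2 * (q : ℤ) + 4) ∧
    (Even q → (PHG.maxArcSize R 3 : ℤ) ≤ 2 * (q : ℤ) ^ 2 - (q : ℤ) + 4) := by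
  classical
  have : Finite F := Nat.finite_of_card_ne_zero (by omega)
  have : Finite (Submodule Rᵐᵒᵖ (Fin 3 → R)) :=
    Finite.of_injective (fun N => (N : Set (Fin 3 → R))) SetLike.coe_injective
  have : Finite (PHG.Point R) := Subtype.finite
  have := Fintype.ofFinite (PHG.Point R)
  have := Fintype.ofFinite (ℙ F (Fin 3 → F))
  obtain ⟨π, h, σ, hc⟩ := exists_isRadicalCoordinate hR hres
  obtain ⟨K, hK, hA⟩ := (PHG.isGreatest_maxArcSize R 3).1
  obtain ⟨p, d, G, hG⟩ := PHG.exists_isCoordinatizedTriarc hc hK hA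
  have hcard : Fintype.card {x // K x = 1} = PHG.maxArcSize R 3 := by
    rw [← hA.1, PHG.multiplicity_eq_card hK]
    simp
  have hT := hG.isHjelmslevTriarc
  have horder := ofField.order_eq (F := F)
  rw [hF] at horder
  -- The estimates treat q = 5 and q ≥ 7; 6 is not a prime power.
  have hq' : q = 5 ∨ 7 ≤ q := by
    have h6 : q ≠ 6 := by
      rintro rfl
      obtain ⟨r, n, hr, -, hn⟩ := (isPrimePow_nat_iff 6).1 hq
      have e2 := (Nat.prime_dvd_prime_iff_eq Nat.prime_two hr).1
        (Nat.prime_two.dvd_of_dvd_pow (hn ▸ by norm_num : 2 ∣ r ^ n))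
      have e3 := (Nat.prime_dvd_prime_iff_eq Nat.prime_three hr).1
        (Nat.prime_three.dvd_of_dvd_pow (hn ▸ by norm_num : 3 ∣ r ^ n))
      omega
    omega
  refine ⟨fun ho => ?_, fun _ => ?_⟩
  · have := hT.card_le_of_odd (horder.symm ▸ hq') (horder.symm ▸ ho)
    rw [hcard, horder] at this
    zify at this
    linarith
  · have := hT.card_le (horder.symm ▸ hq')
    rw [hcard, horder] at this
    zify at this
    linarith
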